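/- Let $\alpha>0$ be a real number and let $\varphi:\mathbb R\to\mathbb R$ be a $C^\infty$ function with compact support. For $t\in\mathbb R$ put $$I_\alpha(t)=\int_0^\infty \exp\!\left(\frac{i t}{x^{\alpha}}\right)\varphi(x)\,dx,\qquad \tilde I_\alpha(t)=I_\alpha(t)-\int_0^\infty\varphi(x)\,dx ,$$ where both integrals converge absolutely. Then the following hold. 1. If $0<\alpha<1$, then $\int_0^\infty \varphi(x)x^{-\alpha}\,dx$ converges absolutely and $$\lim_{t\to 0}\frac{\tilde I_\alpha(t)}{t}= i\int_0^\infty\frac{\varphi(x)}{x^{\alpha}}\,dx$$ (a two-sided limit over real $t\neq 0$). 2. If $\alpha=1$, then $$\lim_{t\to+0}\frac{\tilde I_\alpha(t)}{t\log t}=-i\,\varphi(0).$$ 3. If $\alpha>1$, then $$\lim_{t\to+0}\frac{\tilde I_\alpha(t)}{t^{1/\alpha}}=\frac1\alpha\,\varphi(0)\,e^{-\frac{\pi i}{2\alpha}}\,\Gamma\!\left(-\frac1\alpha\right),$$ where $\Gamma$ is the Gamma function. -/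

import Mathlib

open Filter Topology MeasureTheory
open scoped ContDiff

/-- The integrand `exp (i t / x ^ α) φ(x)`, for `x > 0`. -/
noncomputable def oscIntegrand (α : ℝ) (φ : ℝ → ℝ) (t x : ℝ) : ℂ :=
  Complex.exp (Complex.I * ((t * (1 / x ^ α) : ℝ) : ℂ)) * (φ x : ℂ)

/-- The oscillatory integral `I_α(t) = ∫_0^∞ exp (i t / x ^ α) φ(x) dx`. -/
noncomputable def oscIntegral (α : ℝ) (φ : ℝ → ℝ) (t : ℝ) : ℂ :=
  ∫ x in Set.Ioi (0 : ℝ), oscIntegrand α φ t x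

/-- `Ĩ_α(t) = I_α(t) - ∫_0^∞ φ(x) dx`. -/
noncomputable def oscIntegralTilde (α : ℝ) (φ : ℝ → ℝ) (t : ℝ) : ℂ :=
  oscIntegral α φ t - ((∫ x in Set.Ioi (0 : ℝ), φ x : ℝ) : ℂ)

/-! Everything rests on `Ĩ(t) = ∫ (exp(it/x^α) - 1) φ(x) dx` and on `|exp(iθ) - 1| ≤ min(|θ|, 2)`.
For `α < 1` the weight `x^(-α)` is integrable at `0`, and dominated convergence differentiates under
the integral at `t = 0`. For `α = 1` this just fails: `itφ(0)/x` over `(t, 1]` produces `-iφ(0) t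
log t`, and all other contributions are `O(t)` (`norm_oscIntegralTilde_one_add_le`).

For `α > 1` the scaling `x = t^(1/α) y` extracts `t^(1/α)` and leaves `φ(0) ∫ (exp(i y^(-α)) - 1)
dy` in the limit. With `u = y^(-α)` this is a Gamma integral at `s = -1/α ∈ (-1, 0)`, convergent
thanks to the `-1`. Its value (`integral_cexp_I_mul_sub_one_mul_rpow`) comes from real frequencies
by analytic continuation to `Re z > 0`, an integration by parts that lowers the exponent, and the
limit `z → -i`. -/

theorem Complex.norm_exp_sub_one_le_norm_of_re_nonpos {w : ℂ} (hw : w.re ≤ 0) :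
    ‖Complex.exp w - 1‖ ≤ ‖w‖ := by
  have h := Convex.norm_image_sub_le_of_norm_deriv_le (𝕜 := ℂ) (f := Complex.exp)
    (s := {z : ℂ | z.re ≤ 0}) (x := 0) (y := w) (C := 1)
    (fun x _ => Complex.differentiable_exp x)
    (fun x hx => by
      rw [Complex.deriv_exp, Complex.norm_exp]
      exact Real.exp_le_one_iff.2 hx)
    (convex_halfSpace_re_le 0) (by simp) hw
  simpa using h

theorem Complex.norm_exp_sub_one_le_two_of_re_nonpos {w : ℂ} (hw : w.re ≤ 0) :
    ‖Complex.exp w - 1‖ ≤ 2 := by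
  refine (norm_sub_le _ _).trans ?_
  have : ‖Complex.exp w‖ ≤ 1 := by
    rw [Complex.norm_exp]
    exact Real.exp_le_one_iff.2 hw
  rw [norm_one]
  linarith

/-! ### Gamma integrals with complex frequency -/

/-- The Laplace transform of `u ^ (a - 1)` is holomorphic on the right half plane. -/
theorem hasDerivAt_integral_rpow_mul_exp_neg_mul {a : ℝ} (ha : 0 < a) {z : ℂ} (hz : 0 < z.re) :
    HasDerivAt (fun w : ℂ => ∫ u in Set.Ioi (0 : ℝ), ((u ^ (a - 1) : ℝ) : ℂ) * Complex.exp (-(w * u)))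
      (∫ u in Set.Ioi (0 : ℝ), ((u ^ (a - 1) : ℝ) : ℂ) * (Complex.exp (-(z * u)) * (-(u : ℂ)))) z := by
  have hmeas : ∀ w : ℂ, AEStronglyMeasurable
      (fun u : ℝ => ((u ^ (a - 1) : ℝ) : ℂ) * Complex.exp (-(w * u)))
      (volume.restrict (Set.Ioi (0 : ℝ))) := fun w => by
    refine Measurable.aestronglyMeasurable ?_
    fun_prop
  -- Half of `Re z` leaves a neighbourhood of `z` on which one exponential bound works for every
  -- `w`.
  have hr : 0 < z.re / 2 := by linarith
  refine (hasDerivAt_integral_of_dominated_loc_of_deriv_le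
    (F := fun (w : ℂ) (u : ℝ) => ((u ^ (a - 1) : ℝ) : ℂ) * Complex.exp (-(w * u)))
    (F' := fun (w : ℂ) (u : ℝ) =>
      ((u ^ (a - 1) : ℝ) : ℂ) * (Complex.exp (-(w * u)) * (-(u : ℂ))))
    (bound := fun u : ℝ => u ^ a * Real.exp (-(z.re / 2) * u ^ (1 : ℝ)))
    (s := {w : ℂ | z.re / 2 < w.re}) ?_ ?_ ?_ ?_ ?_ ?_ ?_).2
  · exact (isOpen_lt continuous_const Complex.continuous_re).mem_nhds
      (show z.re / 2 < z.re by linarith)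
  · exact Eventually.of_forall hmeas
  · refine Integrable.mono' (integrableOn_rpow_mul_exp_neg_mul_rpow (p := 1) (s := a - 1)
      (by linarith) one_pos hz) (hmeas z) ?_
    refine (ae_restrict_iff' measurableSet_Ioi).2 (Eventually.of_forall fun u hu => ?_)
    have hu : 0 < u := hu
    rw [norm_mul, Complex.norm_exp, Complex.norm_real, Real.norm_of_nonneg (by positivity)]
    simp
  · refine Measurable.aestronglyMeasurable ?_
    fun_prop
  · refine (ae_restrict_iff' measurableSet_Ioi).2 (Eventually.of_forall fun u hu w hw => ?_)
    have hu : 0 < u := hu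
    have hw : z.re / 2 < w.re := hw
    rw [norm_mul, norm_mul, Complex.norm_exp, Complex.norm_real, norm_neg, Complex.norm_real,
      Real.norm_of_nonneg (by positivity), Real.norm_of_nonneg hu.le, mul_comm (Real.exp _),
      ← mul_assoc, Real.rpow_sub_one hu.ne', div_mul_cancel₀ _ hu.ne', Real.rpow_one]
    gcongr
    simp only [Complex.neg_re, Complex.mul_re, Complex.ofReal_re, Complex.ofReal_im, mul_zero,
      sub_zero]
    nlinarith
  · exact integrableOn_rpow_mul_exp_neg_mul_rpow (p := 1) (by linarith) one_pos hr
  · refine Eventually.of_forall fun u w _ => HasDerivAt.const_mul _ (HasDerivAt.cexp ?_)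
    simpa using! ((hasDerivAt_id w).mul_const (u : ℂ)).neg

/-- The Gamma integral with a complex frequency in the right half plane. -/
theorem integral_rpow_mul_cexp_neg_mul_Ioi {a : ℝ} (ha : 0 < a) {z : ℂ} (hz : 0 < z.re) :
    ∫ u in Set.Ioi (0 : ℝ), ((u ^ (a - 1) : ℝ) : ℂ) * Complex.exp (-(z * u)) =
      (1 / z) ^ (a : ℂ) * Complex.Gamma a := by
  have hopen : IsOpen {w : ℂ | 0 < w.re} := isOpen_lt continuous_const Complex.continuous_re
  have hne : ∀ w ∈ {w : ℂ | 0 < w.re}, w ≠ 0 := by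
    rintro w hw rfl
    simp at hw
  have hslit : ∀ w ∈ {w : ℂ | 0 < w.re}, 1 / w ∈ Complex.slitPlane := by
    intro w hw
    left
    rw [one_div, Complex.inv_re]
    exact div_pos hw (Complex.normSq_pos.2 (hne w hw))
  have hF : AnalyticOnNhd ℂ
      (fun w : ℂ => ∫ u in Set.Ioi (0 : ℝ), ((u ^ (a - 1) : ℝ) : ℂ) * Complex.exp (-(w * u)))
      {w : ℂ | 0 < w.re} := DifferentiableOn.analyticOnNhd (fun w hw =>
    (hasDerivAt_integral_rpow_mul_exp_neg_mul ha hw).differentiableAt.differentiableWithinAt) hopen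
  have hG : AnalyticOnNhd ℂ (fun w : ℂ => (1 / w) ^ (a : ℂ) * Complex.Gamma a)
      {w : ℂ | 0 < w.re} := DifferentiableOn.analyticOnNhd (fun w hw => by
    refine DifferentiableAt.differentiableWithinAt ?_
    refine DifferentiableAt.mul_const (DifferentiableAt.cpow ?_ (by fun_prop) (hslit w hw)) _
    exact (differentiableAt_const _).div differentiableAt_id (hne w hw)) hopen
  have hreal : ∀ r : ℝ, 0 < r →
      ∫ u in Set.Ioi (0 : ℝ), ((u ^ (a - 1) : ℝ) : ℂ) * Complex.exp (-((r : ℂ) * u)) =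
        (1 / (r : ℂ)) ^ (a : ℂ) * Complex.Gamma a := by
    intro r hr
    rw [← Complex.integral_cpow_mul_exp_neg_mul_Ioi (by simpa using ha) hr]
    refine setIntegral_congr_fun measurableSet_Ioi fun u hu => ?_
    have hu : 0 < u := hu
    simp only [Complex.ofReal_cpow hu.le]
    push_cast
    rfl
  -- Identity theorem: agreement on the real ray accumulates at `1`.
  refine hF.eqOn_of_preconnected_of_frequently_eq hG
    (convex_halfSpace_re_gt 0).isPreconnected (z₀ := 1) (by simp) ?_ hz
  have htend : Tendsto (fun r : ℝ => (r : ℂ)) (𝓝[>] 1) (𝓝[≠] 1) := by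
    refine tendsto_nhdsWithin_iff.2 ⟨?_, ?_⟩
    · exact (Complex.continuous_ofReal.tendsto' 1 1 (by simp)).mono_left nhdsWithin_le_nhds
    · filter_upwards [self_mem_nhdsWithin] with r hr
      have hr : (1 : ℝ) < r := hr
      simpa using hr.ne'
  refine htend.frequently (Eventually.frequently ?_)
  filter_upwards [self_mem_nhdsWithin] with r hr
  exact hreal r (lt_trans one_pos hr)

/-- Near `0` the linear bound leaves `x^s`, integrable as `s > -1`; at infinity the constant leaves
`x^(s-1)`, integrable as `s < 0`. -/
theorem integrableOn_Ioi_min_mul_rpow {s : ℝ} (hs : -1 < s) (hs0 : s < 0) (C : ℝ) (hC : 0 ≤ C) :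
    IntegrableOn (fun x : ℝ => min (C * x) 2 * x ^ (s - 1)) (Set.Ioi 0) := by
  have hmeas : Measurable (fun x : ℝ => min (C * x) 2 * x ^ (s - 1)) := by fun_prop
  have hnn : ∀ x : ℝ, 0 < x → ‖min (C * x) 2 * x ^ (s - 1)‖ = min (C * x) 2 * x ^ (s - 1) :=
    fun x hx => Real.norm_of_nonneg (by positivity)
  rw [← Set.Ioc_union_Ioi_eq_Ioi (zero_le_one' ℝ)]
  refine IntegrableOn.union ?_ ?_
  · have h : IntegrableOn (fun x : ℝ => C * x ^ s) (Set.Ioc 0 1) :=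
      (((intervalIntegrable_iff_integrableOn_Ioc_of_le zero_le_one).1
        (intervalIntegral.intervalIntegrable_rpow' hs)).const_mul C)
    refine Integrable.mono' h hmeas.aestronglyMeasurable ?_
    refine (ae_restrict_iff' measurableSet_Ioc).2 (Eventually.of_forall fun x hx => ?_)
    have hx0 : 0 < x := hx.1
    rw [hnn x hx0, Real.rpow_sub_one hx0.ne']
    calc min (C * x) 2 * (x ^ s / x) ≤ C * x * (x ^ s / x) := by
          gcongr
          exact min_le_left _ _
      _ = C * x ^ s := by field_simp
  · have h : IntegrableOn (fun x : ℝ => 2 * x ^ (s - 1)) (Set.Ioi 1) :=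
      (integrableOn_Ioi_rpow_of_lt (by linarith) one_pos).const_mul 2
    refine Integrable.mono' h hmeas.aestronglyMeasurable ?_
    refine (ae_restrict_iff' measurableSet_Ioi).2 (Eventually.of_forall fun x hx => ?_)
    have hx0 : 0 < x := lt_trans one_pos hx
    rw [hnn x hx0]
    gcongr
    exact min_le_right _ _

theorem norm_cexp_neg_mul_sub_one_le_min {z : ℂ} (hz : 0 ≤ z.re) {x : ℝ} (hx : 0 ≤ x) :
    ‖Complex.exp (-(z * x)) - 1‖ ≤ min (‖z‖ * x) 2 := by
  have hre : (-(z * x)).re ≤ 0 := by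
    simp only [Complex.neg_re, Complex.mul_re, Complex.ofReal_re, Complex.ofReal_im, mul_zero,
      sub_zero]
    nlinarith
  refine le_min ?_ (Complex.norm_exp_sub_one_le_two_of_re_nonpos hre)
  refine (Complex.norm_exp_sub_one_le_norm_of_re_nonpos hre).trans_eq ?_
  rw [norm_neg, norm_mul, Complex.norm_real, Real.norm_of_nonneg hx]

/-- The Gamma integral at an exponent in `(-1, 0)`, regularized by subtracting the value at `0`. -/
theorem integral_cexp_neg_mul_sub_one_mul_rpow {s : ℝ} (hs : -1 < s) (hs0 : s < 0) {z : ℂ}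
    (hz : 0 < z.re) :
    ∫ u in Set.Ioi (0 : ℝ), (Complex.exp (-(z * u)) - 1) * ((u ^ (s - 1) : ℝ) : ℂ) =
      z * (1 / z) ^ ((s + 1 : ℝ) : ℂ) * Complex.Gamma s := by
  have hs1 : 0 < s + 1 := by linarith
  have hbound : ∀ x : ℝ, 0 < x →
      ‖(Complex.exp (-(z * x)) - 1) * ((x ^ s / s : ℝ) : ℂ)‖ ≤ min (‖z‖ * x) 2 * (x ^ s / |s|) := by
    intro x hx
    rw [norm_mul, Complex.norm_real, norm_div, Real.norm_of_nonneg (by positivity : 0 ≤ x ^ s),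
      Real.norm_eq_abs]
    gcongr
    exact norm_cexp_neg_mul_sub_one_le_min hz.le hx.le
  -- The boundary terms are `O(x^(s+1))` at `0` and `O(x^s)` at infinity, so both vanish; what
  -- remains is the Gamma integral at `s + 1`.
  have hparts := integral_Ioi_mul_deriv_eq_deriv_mul (a := 0) (a' := (0 : ℂ)) (b' := (0 : ℂ))
    (u := fun x : ℝ => Complex.exp (-(z * x)) - 1)
    (u' := fun x : ℝ => Complex.exp (-(z * x)) * (-z))
    (v := fun x : ℝ => ((x ^ s / s : ℝ) : ℂ)) (v' := fun x : ℝ => ((x ^ (s - 1) : ℝ) : ℂ))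
    ?_ ?_ ?_ ?_ ?_ ?_
  · rw [hparts]
    have hint := integral_rpow_mul_cexp_neg_mul_Ioi hs1 hz
    rw [add_sub_cancel_right] at hint
    have hG : Complex.Gamma ((s + 1 : ℝ) : ℂ) = s * Complex.Gamma s := by
      rw [Complex.ofReal_add, Complex.ofReal_one, Complex.Gamma_add_one]
      exact_mod_cast hs0.ne
    have hsC : (s : ℂ) ≠ 0 := by exact_mod_cast hs0.ne
    have : ∀ x : ℝ, Complex.exp (-(z * x)) * (-z) * ((x ^ s / s : ℝ) : ℂ) =
        (-z / s) * (((x ^ s : ℝ) : ℂ) * Complex.exp (-(z * x))) := fun x => by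
      push_cast
      ring
    simp only [this]
    rw [integral_const_mul, hint, hG]
    field_simp
    ring
  · intro x _
    refine HasDerivAt.sub_const _ (HasDerivAt.cexp ?_)
    simpa using! ((Complex.ofRealCLM.hasDerivAt (x := x)).const_mul z).neg
  · intro x hx
    refine HasDerivAt.ofReal_comp ?_
    have := (Real.hasDerivAt_rpow_const (p := s) (Or.inl (ne_of_gt hx))).div_const s
    rwa [mul_div_cancel_left₀ _ hs0.ne] at this
  · refine Integrable.mono' (integrableOn_Ioi_min_mul_rpow hs hs0 ‖z‖ (norm_nonneg z))
      (Measurable.aestronglyMeasurable ?_) ?_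
    · simp only [Pi.mul_def]
      fun_prop
    refine (ae_restrict_iff' measurableSet_Ioi).2 (Eventually.of_forall fun x hx => ?_)
    have hx : 0 < x := hx
    rw [Pi.mul_apply, norm_mul, Complex.norm_real, Real.norm_of_nonneg (by positivity)]
    gcongr
    exact norm_cexp_neg_mul_sub_one_le_min hz.le hx.le
  · refine Integrable.mono' ((integrableOn_rpow_mul_exp_neg_mul_rpow (p := 1) (s := s)
      hs one_pos hz).const_mul (‖z‖ / |s|)) (Measurable.aestronglyMeasurable ?_) ?_
    · simp only [Pi.mul_def]
      fun_prop
    refine (ae_restrict_iff' measurableSet_Ioi).2 (Eventually.of_forall fun x hx => ?_)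
    have hx : 0 < x := hx
    rw [Pi.mul_apply, norm_mul, norm_mul, Complex.norm_exp, Complex.norm_real, norm_div,
      Real.norm_of_nonneg (by positivity : 0 ≤ x ^ s), Real.norm_eq_abs, norm_neg, Real.rpow_one]
    simp only [Complex.neg_re, Complex.mul_re, Complex.ofReal_re, Complex.ofReal_im, mul_zero,
      sub_zero, neg_mul]
    apply le_of_eq
    ring
  · have h0 : Tendsto (fun x : ℝ => ‖z‖ / |s| * x ^ (s + 1)) (𝓝[>] 0) (𝓝 0) := by
      have := ((Real.continuous_rpow_const hs1.le).tendsto' 0 0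
        (Real.zero_rpow hs1.ne')).const_mul (‖z‖ / |s|)
      rw [mul_zero] at this
      exact this.mono_left nhdsWithin_le_nhds
    refine squeeze_zero_norm' ?_ h0
    filter_upwards [self_mem_nhdsWithin] with x hx
    have hx : 0 < x := hx
    refine (hbound x hx).trans ?_
    rw [Real.rpow_add_one hx.ne']
    calc min (‖z‖ * x) 2 * (x ^ s / |s|) ≤ ‖z‖ * x * (x ^ s / |s|) := by
          gcongr
          exact min_le_left _ _
      _ = _ := by ring
  · have h0 : Tendsto (fun x : ℝ => 2 / |s| * x ^ s) atTop (𝓝 0) := by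
      have := (tendsto_rpow_neg_atTop (neg_pos.2 hs0)).const_mul (2 / |s|)
      simpa using this
    refine squeeze_zero_norm' ?_ h0
    filter_upwards [eventually_gt_atTop 0] with x hx
    refine (hbound x hx).trans ?_
    calc min (‖z‖ * x) 2 * (x ^ s / |s|) ≤ 2 * (x ^ s / |s|) := by
          gcongr
          exact min_le_right _ _
      _ = _ := by ring

/-- The regularized Gamma integral on the imaginary axis. -/
theorem integral_cexp_I_mul_sub_one_mul_rpow {s : ℝ} (hs : -1 < s) (hs0 : s < 0) :
    ∫ u in Set.Ioi (0 : ℝ), (Complex.exp (Complex.I * u) - 1) * ((u ^ (s - 1) : ℝ) : ℂ) =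
      Complex.exp (s / 2 * Real.pi * Complex.I) * Complex.Gamma s := by
  have hz : Tendsto (fun ε : ℝ => (ε : ℂ) - Complex.I) (𝓝[>] 0) (𝓝 (-Complex.I)) := by
    have : Continuous (fun ε : ℝ => (ε : ℂ) - Complex.I) := by fun_prop
    exact (this.tendsto' 0 (-Complex.I) (by simp)).mono_left nhdsWithin_le_nhds
  have hL : Tendsto (fun ε : ℝ => ∫ u in Set.Ioi (0 : ℝ),
      (Complex.exp (-(((ε : ℂ) - Complex.I) * u)) - 1) * ((u ^ (s - 1) : ℝ) : ℂ)) (𝓝[>] 0)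
      (𝓝 (∫ u in Set.Ioi (0 : ℝ), (Complex.exp (Complex.I * u) - 1) * ((u ^ (s - 1) : ℝ) : ℂ))) := by
    -- The slope `2` bounds `‖ε - i‖` for `0 < ε < 1`.
    refine tendsto_integral_filter_of_dominated_convergence
      (fun x : ℝ => min (2 * x) 2 * x ^ (s - 1)) ?_ ?_
      (integrableOn_Ioi_min_mul_rpow hs hs0 2 zero_le_two) ?_
    · refine Eventually.of_forall fun ε => Measurable.aestronglyMeasurable ?_
      fun_prop
    · filter_upwards [Ioo_mem_nhdsGT (one_pos : (0 : ℝ) < 1)] with ε hε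
      refine (ae_restrict_iff' measurableSet_Ioi).2 (Eventually.of_forall fun x hx => ?_)
      have hx : 0 < x := hx
      rw [norm_mul, Complex.norm_real, Real.norm_of_nonneg (by positivity)]
      gcongr
      refine (norm_cexp_neg_mul_sub_one_le_min (by simpa using hε.1.le) hx.le).trans ?_
      gcongr
      refine (norm_sub_le _ _).trans ?_
      rw [Complex.norm_real, Real.norm_of_nonneg hε.1.le, Complex.norm_I]
      linarith [hε.2]
    · refine Eventually.of_forall fun x => ?_
      have : Continuous fun w : ℂ => (Complex.exp (-(w * x)) - 1) * ((x ^ (s - 1) : ℝ) : ℂ) := by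
        fun_prop
      have h := (this.tendsto (-Complex.I)).comp hz
      simpa [Function.comp_def] using h
  have hI : (1 / -Complex.I) = Complex.I := by simp
  have hR : Tendsto (fun ε : ℝ => ((ε : ℂ) - Complex.I) *
      (1 / ((ε : ℂ) - Complex.I)) ^ ((s + 1 : ℝ) : ℂ) * Complex.Gamma s) (𝓝[>] 0)
      (𝓝 (-Complex.I * (1 / -Complex.I) ^ ((s + 1 : ℝ) : ℂ) * Complex.Gamma s)) := by
    refine Tendsto.mul_const _ (hz.mul ?_)
    refine Tendsto.cpow (tendsto_const_nhds.div hz (by simp)) tendsto_const_nhds ?_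
    -- `1/(-i) = i` is off the branch cut, so the principal power is continuous there.
    rw [hI]
    exact Or.inr (by simp)
  have heq := tendsto_nhds_unique (hL.congr' ?_) hR
  · rw [heq, hI, Complex.ofReal_add, Complex.ofReal_one, Complex.cpow_add _ _ Complex.I_ne_zero,
      Complex.cpow_one, Complex.cpow_def_of_ne_zero Complex.I_ne_zero, Complex.log_I]
    have : -Complex.I * (Complex.exp (Real.pi / 2 * Complex.I * s) * Complex.I) =
        Complex.exp (Real.pi / 2 * Complex.I * s) := by
      linear_combination (-Complex.exp (Real.pi / 2 * Complex.I * s)) * Complex.I_mul_I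
    rw [this]
    congr 2
    ring
  · filter_upwards [self_mem_nhdsWithin] with ε hε
    exact integral_cexp_neg_mul_sub_one_mul_rpow hs hs0 (by simpa using hε)

/-! ### The integral of `(exp(it/x^α) - 1) φ(x)` and the case `α < 1` -/

section
variable {α : ℝ} {φ : ℝ → ℝ}

theorem measurable_cexp_I_mul_div_rpow (α t : ℝ) :
    Measurable fun x : ℝ => Complex.exp (Complex.I * ((t * (1 / x ^ α) : ℝ) : ℂ)) := by
  fun_prop

theorem integrableOn_oscIntegrand (hφ : IntegrableOn φ (Set.Ioi (0 : ℝ))) (t : ℝ) :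
    IntegrableOn (oscIntegrand α φ t) (Set.Ioi (0 : ℝ)) := by
  refine Integrable.mono hφ ((measurable_cexp_I_mul_div_rpow α t).aestronglyMeasurable.mul
    (Complex.continuous_ofReal.comp_aestronglyMeasurable hφ.aestronglyMeasurable)) ?_
  refine Eventually.of_forall fun x => ?_
  rw [oscIntegrand, norm_mul, Complex.norm_exp_I_mul_ofReal, one_mul, Complex.norm_real]

theorem oscIntegralTilde_eq_integral (hφ : IntegrableOn φ (Set.Ioi (0 : ℝ))) (t : ℝ) :
    oscIntegralTilde α φ t = ∫ x in Set.Ioi (0 : ℝ),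
      (Complex.exp (Complex.I * ((t * (1 / x ^ α) : ℝ) : ℂ)) - 1) * (φ x : ℂ) := by
  have hφC : IntegrableOn (fun x => (φ x : ℂ)) (Set.Ioi (0 : ℝ)) := hφ.ofReal
  rw [oscIntegralTilde, oscIntegral, ← integral_complex_ofReal,
    ← integral_sub (integrableOn_oscIntegrand hφ t) hφC]
  refine integral_congr_ae (Eventually.of_forall fun x => ?_)
  simp only [oscIntegrand]
  ring

theorem integrableOn_div_rpow (hα : 0 < α) (hα1 : α < 1) {M : ℝ} (hM : ∀ x, ‖φ x‖ ≤ M)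
    (hφ : IntegrableOn φ (Set.Ioi (0 : ℝ))) :
    IntegrableOn (fun x : ℝ => φ x / x ^ α) (Set.Ioi (0 : ℝ)) := by
  have hmeas : AEStronglyMeasurable (fun x : ℝ => φ x / x ^ α)
      (volume.restrict (Set.Ioi (0 : ℝ))) := by
    simp only [div_eq_mul_inv]
    refine hφ.aestronglyMeasurable.mul (Measurable.aestronglyMeasurable ?_)
    fun_prop
  have hsub : Set.Ioi (1 : ℝ) ⊆ Set.Ioi 0 := Set.Ioi_subset_Ioi zero_le_one
  rw [← Set.Ioc_union_Ioi_eq_Ioi (zero_le_one' ℝ)]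
  refine IntegrableOn.union ?_ ?_
  · have h : IntegrableOn (fun x : ℝ => M * x ^ (-α)) (Set.Ioc 0 1) :=
      (((intervalIntegrable_iff_integrableOn_Ioc_of_le zero_le_one).1
        (intervalIntegral.intervalIntegrable_rpow' (by linarith))).const_mul M)
    refine Integrable.mono' h (hmeas.mono_measure
      (Measure.restrict_mono Set.Ioc_subset_Ioi_self le_rfl)) ?_
    refine (ae_restrict_iff' measurableSet_Ioc).2 (Eventually.of_forall fun x hx => ?_)
    have hx0 : 0 < x := hx.1
    rw [norm_div, Real.norm_of_nonneg (by positivity : 0 ≤ x ^ α), Real.rpow_neg hx0.le,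
      div_eq_mul_inv]
    gcongr
    exact hM x
  · refine Integrable.mono (hφ.mono_set hsub) (hmeas.mono_measure
      (Measure.restrict_mono hsub le_rfl)) ?_
    refine (ae_restrict_iff' measurableSet_Ioi).2 (Eventually.of_forall fun x hx => ?_)
    have hx1 : (1 : ℝ) < x := hx
    have hx0 : 0 < x := lt_trans one_pos hx1
    rw [norm_div, Real.norm_of_nonneg (by positivity : 0 ≤ x ^ α)]
    exact div_le_self (norm_nonneg _) (Real.one_le_rpow hx1.le hα.le)

theorem tendsto_oscIntegralTilde_div (hφ : IntegrableOn φ (Set.Ioi (0 : ℝ)))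
    (hφα : IntegrableOn (fun x : ℝ => φ x / x ^ α) (Set.Ioi (0 : ℝ))) :
    Tendsto (fun t : ℝ => oscIntegralTilde α φ t / (t : ℂ)) (𝓝[≠] 0)
      (𝓝 (Complex.I * ((∫ x in Set.Ioi (0 : ℝ), φ x / x ^ α : ℝ) : ℂ))) := by
  simp only [oscIntegralTilde_eq_integral hφ]
  rw [← integral_complex_ofReal, ← integral_const_mul]
  simp only [← integral_div]
  refine tendsto_integral_filter_of_dominated_convergence (fun x => ‖φ x / x ^ α‖) ?_ ?_
    hφα.norm ?_
  · refine Eventually.of_forall fun t => ?_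
    simp only [div_eq_mul_inv _ (t : ℂ)]
    exact ((((measurable_cexp_I_mul_div_rpow α t).sub_const 1).aestronglyMeasurable).mul
      (Complex.continuous_ofReal.comp_aestronglyMeasurable hφ.aestronglyMeasurable)).mul_const _
  · filter_upwards [self_mem_nhdsWithin] with t ht
    refine Eventually.of_forall fun x => ?_
    have ht : t ≠ 0 := ht
    rw [norm_div, norm_mul, Complex.norm_real, Complex.norm_real, div_le_iff₀ (norm_pos_iff.2 ht)]
    calc _ ≤ ‖t * (1 / x ^ α)‖ * ‖φ x‖ := by
          gcongr
          exact Real.norm_exp_I_mul_ofReal_sub_one_le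
      _ = ‖φ x / x ^ α‖ * ‖t‖ := by
          rw [norm_mul, norm_div, norm_div, norm_one]
          ring
  · refine Eventually.of_forall fun x => ?_
    have hd : HasDerivAt (fun t : ℝ => Complex.exp (Complex.I * ((t * (1 / x ^ α) : ℝ) : ℂ)))
        (Complex.I * ((1 / x ^ α : ℝ) : ℂ)) 0 := by
      have h1 : HasDerivAt (fun t : ℝ => ((t * (1 / x ^ α) : ℝ) : ℂ))
          (((1 / x ^ α : ℝ) : ℂ)) 0 := by
        refine HasDerivAt.ofReal_comp ?_
        simpa using (hasDerivAt_id (0 : ℝ)).mul_const (1 / x ^ α)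
      simpa using (h1.const_mul Complex.I).cexp
    -- The pointwise limit is the derivative of the phase factor at `t = 0`.
    have h := (hasDerivAt_iff_tendsto_slope.1 hd).mul_const (φ x : ℂ)
    have e : Complex.I * ((φ x / x ^ α : ℝ) : ℂ) =
        Complex.I * ((1 / x ^ α : ℝ) : ℂ) * (φ x : ℂ) := by
      push_cast
      ring
    rw [e]
    refine h.congr fun t => ?_
    rw [slope_def_module, Complex.real_smul]
    simp
    ring

/-! ### The critical case `α = 1` -/

/-- The logarithmic leading term at the critical exponent `1`, with an error `O(t)`. -/
theorem norm_oscIntegralTilde_one_add_le (hφ : IntegrableOn φ (Set.Ioi (0 : ℝ))) {M L : ℝ}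
    (hM : ∀ x, ‖φ x‖ ≤ M) (hL : ∀ x, ‖φ x - φ 0‖ ≤ L * ‖x‖) {t : ℝ} (ht : 0 < t) (ht1 : t < 1) :
    ‖oscIntegralTilde 1 φ t + Complex.I * (φ 0 : ℂ) * ((t * Real.log t : ℝ) : ℂ)‖ ≤
      (3 * M + L + ∫ x in Set.Ioi (0 : ℝ), ‖φ x‖) * t := by
  have hM0 : 0 ≤ M := (norm_nonneg _).trans (hM 0)
  have hL0 : 0 ≤ L := by simpa using (norm_nonneg _).trans (hL 1)
  set f : ℝ → ℂ := fun x =>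
    (Complex.exp (Complex.I * ((t * (1 / x ^ (1 : ℝ)) : ℝ) : ℂ)) - 1) * (φ x : ℂ) with hf
  have hfint : IntegrableOn f (Set.Ioi 0) := by
    have hφC : IntegrableOn (fun x => (φ x : ℂ)) (Set.Ioi (0 : ℝ)) := hφ.ofReal
    refine ((integrableOn_oscIntegrand (α := 1) hφ t).sub hφC).congr
      (Eventually.of_forall fun x => ?_)
    simp only [Pi.sub_apply, oscIntegrand, hf]
    ring
  have hsq : IntegrableOn (fun x : ℝ => x ^ (-2 : ℝ)) (Set.Ioi t) :=
    integrableOn_Ioi_rpow_of_lt (by norm_num) ht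
  have hsub1 : Set.Ioc 0 t ⊆ Set.Ioi (0 : ℝ) := Set.Ioc_subset_Ioi_self
  have hsub2 : Set.Ioc t 1 ⊆ Set.Ioi (0 : ℝ) := fun x hx => ht.trans hx.1
  have hsub3 : Set.Ioi 1 ⊆ Set.Ioi (0 : ℝ) := Set.Ioi_subset_Ioi zero_le_one
  -- On `(0, t]` the phase `t/x` is not small, but the interval is short; beyond `1` it is at most
  -- `t`. The logarithm comes from `(t, 1]`.
  have hsplit : ∫ x in Set.Ioi (0 : ℝ), f x =
      (∫ x in Set.Ioc 0 t, f x) + (∫ x in Set.Ioc t 1, f x) + ∫ x in Set.Ioi 1, f x := by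
    rw [← Set.Ioc_union_Ioi_eq_Ioi (zero_le_one' ℝ), setIntegral_union
      (Set.Ioc_disjoint_Ioi le_rfl) measurableSet_Ioi
      (hfint.mono_set Set.Ioc_subset_Ioi_self) (hfint.mono_set hsub3),
      ← Set.Ioc_union_Ioc_eq_Ioc ht.le ht1.le, setIntegral_union
      (Set.Ioc_disjoint_Ioc_of_le le_rfl) measurableSet_Ioc
      (hfint.mono_set hsub1) (hfint.mono_set hsub2)]
  have hinv : IntegrableOn (fun x : ℝ => (x⁻¹ : ℝ)) (Set.Ioc t 1) :=
    (intervalIntegrable_iff_integrableOn_Ioc_of_le ht1.le).1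
      (intervalIntegrable_inv_iff.2 (Or.inr (by
        rw [Set.uIcc_of_le ht1.le]
        exact fun h => absurd h.1 (not_le.2 ht))))
  have hlog : ∫ x in Set.Ioc t 1, (x⁻¹ : ℝ) = -Real.log t := by
    rw [← intervalIntegral.integral_of_le ht1.le, integral_inv_of_pos ht one_pos, one_div,
      Real.log_inv]
  have hmain : Complex.I * (φ 0 : ℂ) * ((t * Real.log t : ℝ) : ℂ) =
      - ∫ x in Set.Ioc t 1, Complex.I * (φ 0 : ℂ) * (t : ℂ) * ((x⁻¹ : ℝ) : ℂ) := by
    rw [integral_const_mul, integral_complex_ofReal, hlog]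
    push_cast
    ring
  have h1 : ‖∫ x in Set.Ioc 0 t, f x‖ ≤ 2 * M * t := by
    refine (norm_setIntegral_le_of_norm_le_const (C := 2 * M) (by simp) fun x _ => ?_).trans_eq ?_
    · rw [hf, norm_mul, Complex.norm_real]
      gcongr
      · exact Complex.norm_exp_sub_one_le_two_of_re_nonpos (by simp)
      · exact hM x
    · simp [ht.le]
  have h3 : ‖∫ x in Set.Ioi 1, f x‖ ≤ t * ∫ x in Set.Ioi (0 : ℝ), ‖φ x‖ := by
    have hle : ∀ x ∈ Set.Ioi (1 : ℝ), ‖f x‖ ≤ t * ‖φ x‖ := fun x hx => by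
      have hx1 : (1 : ℝ) < x := hx
      have hx0 : 0 < x := one_pos.trans hx1
      rw [hf, norm_mul, Complex.norm_real]
      gcongr
      refine Real.norm_exp_I_mul_ofReal_sub_one_le.trans ?_
      rw [Real.rpow_one, Real.norm_of_nonneg (by positivity)]
      exact mul_le_of_le_one_right ht.le ((div_le_one hx0).2 hx1.le)
    calc ‖∫ x in Set.Ioi 1, f x‖ ≤ ∫ x in Set.Ioi 1, t * ‖φ x‖ :=
          norm_integral_le_of_norm_le ((hφ.mono_set hsub3).norm.const_mul t)
            ((ae_restrict_iff' measurableSet_Ioi).2 (Eventually.of_forall hle))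
      _ = t * ∫ x in Set.Ioi 1, ‖φ x‖ := integral_const_mul _ _
      _ ≤ _ := by
          gcongr ?_ * ?_
          exact setIntegral_mono_set hφ.norm (Eventually.of_forall fun x => norm_nonneg _)
            hsub3.eventuallyLE
  have h2 : ‖∫ x in Set.Ioc t 1,
      (f x - Complex.I * (φ 0 : ℂ) * (t : ℂ) * ((x⁻¹ : ℝ) : ℂ))‖ ≤ M * t + L * t := by
    have hle : ∀ x ∈ Set.Ioc t 1, ‖f x - Complex.I * (φ 0 : ℂ) * (t : ℂ) * ((x⁻¹ : ℝ) : ℂ)‖ ≤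
        M * t ^ 2 * x ^ (-2 : ℝ) + L * t := fun x hx => by
      have hx0 : 0 < x := ht.trans hx.1
      have hθ : ‖Complex.I * ((t * (1 / x) : ℝ) : ℂ)‖ = t / x := by
        rw [norm_mul, Complex.norm_I, one_mul, Complex.norm_real,
          Real.norm_of_nonneg (by positivity), mul_one_div]
      -- Taylor remainder times `φ(x)`, at most `M t²/x²`, plus linear phase times `φ(x) - φ(0)`, at
      -- most `(t/x)(L x) = L t`. The Taylor bound needs `t/x ≤ 1`, hence the cut at `t`.
      have hdec : f x - Complex.I * (φ 0 : ℂ) * (t : ℂ) * ((x⁻¹ : ℝ) : ℂ) =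
          (Complex.exp (Complex.I * ((t * (1 / x) : ℝ) : ℂ)) - 1 -
            Complex.I * ((t * (1 / x) : ℝ) : ℂ)) * (φ x : ℂ) +
          Complex.I * ((t * (1 / x) : ℝ) : ℂ) * ((φ x - φ 0 : ℝ) : ℂ) := by
        simp only [hf, Real.rpow_one]
        push_cast
        ring
      rw [hdec]
      refine (norm_add_le _ _).trans (add_le_add ?_ ?_)
      · rw [norm_mul, Complex.norm_real]
        have h := Complex.norm_exp_sub_one_sub_id_le
          (x := Complex.I * ((t * (1 / x) : ℝ) : ℂ)) (by
            rw [hθ]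
            exact (div_le_one hx0).2 hx.1.le)
        rw [hθ] at h
        calc _ ≤ (t / x) ^ 2 * M := by
              gcongr
              exact hM x
          _ = _ := by
              rw [Real.rpow_neg hx0.le, Real.rpow_two]
              field_simp
      · rw [norm_mul, hθ, Complex.norm_real]
        calc _ ≤ t / x * (L * ‖x‖) := by
              gcongr
              exact hL x
          _ = _ := by
              rw [Real.norm_of_nonneg hx0.le]
              field_simp
    have hbi : IntegrableOn (fun x : ℝ => M * t ^ 2 * x ^ (-2 : ℝ)) (Set.Ioc t 1) :=
      (hsq.mono_set Set.Ioc_subset_Ioi_self).const_mul _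
    have hci : IntegrableOn (fun _ : ℝ => L * t) (Set.Ioc t 1) :=
      integrableOn_const (by simp)
    have hbci : IntegrableOn (fun x : ℝ => M * t ^ 2 * x ^ (-2 : ℝ) + L * t) (Set.Ioc t 1) :=
      hbi.add hci
    calc _ ≤ ∫ x in Set.Ioc t 1, (M * t ^ 2 * x ^ (-2 : ℝ) + L * t) :=
          norm_integral_le_of_norm_le hbci
            ((ae_restrict_iff' measurableSet_Ioc).2 (Eventually.of_forall hle))
      _ = M * t ^ 2 * (∫ x in Set.Ioc t 1, x ^ (-2 : ℝ)) + (1 - t) * (L * t) := by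
          rw [integral_add hbi hci, integral_const_mul, setIntegral_const]
          simp [ht1.le]
      _ ≤ M * t ^ 2 * (∫ x in Set.Ioi t, x ^ (-2 : ℝ)) + 1 * (L * t) := by
          gcongr ?_ * ?_ + ?_ * ?_
          · refine setIntegral_mono_set hsq ?_ Set.Ioc_subset_Ioi_self.eventuallyLE
            refine (ae_restrict_iff' measurableSet_Ioi).2 (Eventually.of_forall fun x hx => ?_)
            exact Real.rpow_nonneg (ht.le.trans (le_of_lt hx)) _
          · linarith
      _ = M * t + L * t := by
          rw [integral_Ioi_rpow_of_lt (by norm_num) ht]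
          norm_num
          rw [Real.rpow_neg_one]
          field_simp
  have hgint : IntegrableOn
      (fun x : ℝ => Complex.I * (φ 0 : ℂ) * (t : ℂ) * ((x⁻¹ : ℝ) : ℂ)) (Set.Ioc t 1) :=
    hinv.ofReal.const_mul _
  rw [integral_sub (hfint.mono_set hsub2) hgint] at h2
  rw [oscIntegralTilde_eq_integral hφ, hmain, hsplit]
  calc _ = ‖(∫ x in Set.Ioc 0 t, f x) + ((∫ x in Set.Ioc t 1, f x) -
          ∫ x in Set.Ioc t 1, Complex.I * (φ 0 : ℂ) * (t : ℂ) * ((x⁻¹ : ℝ) : ℂ)) +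
          ∫ x in Set.Ioi 1, f x‖ := by
        congr 1
        ring
    _ ≤ 2 * M * t + (M * t + L * t) + t * ∫ x in Set.Ioi (0 : ℝ), ‖φ x‖ :=
        (norm_add_le _ _).trans (add_le_add ((norm_add_le _ _).trans (add_le_add h1 h2)) h3)
    _ = _ := by ring

theorem tendsto_oscIntegralTilde_one_div_mul_log (hφ : IntegrableOn φ (Set.Ioi (0 : ℝ))) {M L : ℝ}
    (hM : ∀ x, ‖φ x‖ ≤ M) (hL : ∀ x, ‖φ x - φ 0‖ ≤ L * ‖x‖) :
    Tendsto (fun t : ℝ => oscIntegralTilde 1 φ t / ((t * Real.log t : ℝ) : ℂ)) (𝓝[>] 0)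
      (𝓝 (-Complex.I * (φ 0 : ℂ))) := by
  rw [tendsto_iff_norm_sub_tendsto_zero]
  set C : ℝ := 3 * M + L + ∫ x in Set.Ioi (0 : ℝ), ‖φ x‖ with hC
  have hlim : Tendsto (fun t : ℝ => C / -Real.log t) (𝓝[>] 0) (𝓝 0) :=
    (tendsto_neg_atBot_atTop.comp Real.tendsto_log_nhdsGT_zero).const_div_atTop C
  refine squeeze_zero' (Eventually.of_forall fun t => norm_nonneg _) ?_ hlim
  filter_upwards [Ioo_mem_nhdsGT (one_pos : (0 : ℝ) < 1)] with t ht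
  have hlog : Real.log t < 0 := Real.log_neg ht.1 ht.2
  have hne : ((t * Real.log t : ℝ) : ℂ) ≠ 0 := by
    exact_mod_cast mul_ne_zero ht.1.ne' hlog.ne
  have e : oscIntegralTilde 1 φ t / ((t * Real.log t : ℝ) : ℂ) - -Complex.I * (φ 0 : ℂ) =
      (oscIntegralTilde 1 φ t + Complex.I * (φ 0 : ℂ) * ((t * Real.log t : ℝ) : ℂ)) /
        ((t * Real.log t : ℝ) : ℂ) := by
    rw [eq_div_iff hne, sub_mul, div_mul_cancel₀ _ hne]
    ring
  rw [e, norm_div, Complex.norm_real, norm_mul, Real.norm_of_nonneg ht.1.le, Real.norm_eq_abs,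
    abs_of_neg hlog]
  have hpos : 0 < -Real.log t := by linarith
  rw [div_le_div_iff₀ (mul_pos ht.1 hpos) hpos]
  calc _ ≤ C * t * -Real.log t := by
        gcongr
        exact norm_oscIntegralTilde_one_add_le hφ hM hL ht.1 ht.2
    _ = _ := by ring

/-! ### The case `α > 1` -/

theorem integral_cexp_I_div_rpow_sub_one (hα : 1 < α) :
    ∫ y in Set.Ioi (0 : ℝ), (Complex.exp (Complex.I * ((1 / y ^ α : ℝ) : ℂ)) - 1) =
      (1 / (α : ℂ)) * Complex.exp (-(1 / (2 * (α : ℂ))) * (Real.pi : ℂ) * Complex.I) *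
          (Real.Gamma (-(1 / α)) : ℂ) := by
  have hα0 : 0 < α := one_pos.trans hα
  have hαC : (α : ℂ) ≠ 0 := by exact_mod_cast hα0.ne'
  have hinv : 0 < 1 / α := by positivity
  have hs : -1 < -(1 / α) := by
    rw [neg_lt_neg_iff, div_lt_one hα0]
    exact hα
  have hs0 : -(1 / α) < 0 := by linarith
  -- Substitution `y = u^(-1/α)`, whose Jacobian supplies `1/α` and the weight `u^(s-1)` with `s =
  -- -1/α`.
  rw [← integral_comp_rpow_Ioi _ hs0.ne]
  have : ∀ u ∈ Set.Ioi (0 : ℝ), (|-(1 / α)| * u ^ (-(1 / α) - 1)) •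
      (Complex.exp (Complex.I * ((1 / (u ^ (-(1 / α))) ^ α : ℝ) : ℂ)) - 1) =
      (1 / α : ℂ) * ((Complex.exp (Complex.I * u) - 1) * ((u ^ (-(1 / α) - 1) : ℝ) : ℂ)) := by
    intro u hu
    have hu : 0 < u := hu
    rw [← Real.rpow_mul hu.le, neg_mul, one_div_mul_cancel hα0.ne', Real.rpow_neg_one, one_div u⁻¹,
      inv_inv, abs_neg, abs_of_pos (by positivity), Complex.real_smul]
    push_cast
    ring
  rw [setIntegral_congr_fun measurableSet_Ioi this, integral_const_mul,
    integral_cexp_I_mul_sub_one_mul_rpow hs hs0, Complex.Gamma_ofReal, ← mul_assoc]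
  congr 4
  push_cast
  field_simp

theorem integrableOn_Ioi_min_rpow_neg (hα : 1 < α) :
    IntegrableOn (fun y : ℝ => min (1 / y ^ α) 2) (Set.Ioi (0 : ℝ)) := by
  have hmeas : Measurable (fun y : ℝ => min (1 / y ^ α) 2) := by fun_prop
  have hnn : ∀ y : ℝ, 0 < y → ‖min (1 / y ^ α) 2‖ = min (1 / y ^ α) 2 :=
    fun y hy => Real.norm_of_nonneg (by positivity)
  rw [← Set.Ioc_union_Ioi_eq_Ioi (zero_le_one' ℝ)]
  refine IntegrableOn.union ?_ ?_
  · refine Integrable.mono' (integrableOn_const (C := (2 : ℝ)) (by simp))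
      hmeas.aestronglyMeasurable ?_
    refine (ae_restrict_iff' measurableSet_Ioc).2 (Eventually.of_forall fun y hy => ?_)
    rw [hnn y hy.1]
    exact min_le_right _ _
  · refine Integrable.mono' (integrableOn_Ioi_rpow_of_lt (a := -α) (by linarith) one_pos)
      hmeas.aestronglyMeasurable ?_
    refine (ae_restrict_iff' measurableSet_Ioi).2 (Eventually.of_forall fun y hy => ?_)
    have hy : 0 < y := one_pos.trans hy
    rw [hnn y hy, Real.rpow_neg hy.le, ← one_div]
    exact min_le_left _ _

/-- After `x = t^(1/α) y` the phase no longer depends on `t`, which survives only inside `φ`. -/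
theorem oscIntegralTilde_eq_rpow_mul_integral (hα : 0 < α) (hφ : IntegrableOn φ (Set.Ioi (0 : ℝ)))
    {t : ℝ} (ht : 0 < t) :
    oscIntegralTilde α φ t = ((t ^ (1 / α) : ℝ) : ℂ) * ∫ y in Set.Ioi (0 : ℝ),
      (Complex.exp (Complex.I * ((1 / y ^ α : ℝ) : ℂ)) - 1) * (φ (t ^ (1 / α) * y) : ℂ) := by
  have hc : 0 < t ^ (1 / α) := by positivity
  have h := integral_comp_mul_left_Ioi (fun x : ℝ =>
    (Complex.exp (Complex.I * ((t * (1 / x ^ α) : ℝ) : ℂ)) - 1) * (φ x : ℂ)) 0 hc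
  rw [mul_zero] at h
  rw [oscIntegralTilde_eq_integral hφ, ← Complex.real_smul, ← inv_smul_eq_iff₀ hc.ne', ← h]
  refine setIntegral_congr_fun measurableSet_Ioi fun y hy => ?_
  have hy : 0 < y := hy
  have e : t * (1 / (t ^ (1 / α) * y) ^ α) = 1 / y ^ α := by
    rw [Real.mul_rpow hc.le hy.le, ← Real.rpow_mul ht.le, one_div_mul_cancel hα.ne', Real.rpow_one]
    field_simp
  simp only [e]

theorem tendsto_oscIntegralTilde_div_rpow (hα : 1 < α) (hφ : IntegrableOn φ (Set.Ioi (0 : ℝ)))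
    (hcont : Continuous φ) {M : ℝ} (hM : ∀ x, ‖φ x‖ ≤ M) :
    Tendsto (fun t : ℝ => oscIntegralTilde α φ t / ((t ^ (1 / α) : ℝ) : ℂ)) (𝓝[>] 0)
      (𝓝 ((1 / (α : ℂ)) * (φ 0 : ℂ) *
        Complex.exp (-(1 / (2 * (α : ℂ))) * (Real.pi : ℂ) * Complex.I) *
        (Real.Gamma (-(1 / α)) : ℂ))) := by
  have hα0 : 0 < α := one_pos.trans hα
  have hlim : (1 / (α : ℂ)) * (φ 0 : ℂ) *
        Complex.exp (-(1 / (2 * (α : ℂ))) * (Real.pi : ℂ) * Complex.I) *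
        (Real.Gamma (-(1 / α)) : ℂ) = ∫ y in Set.Ioi (0 : ℝ),
      (Complex.exp (Complex.I * ((1 / y ^ α : ℝ) : ℂ)) - 1) * (φ 0 : ℂ) := by
    rw [integral_mul_const, integral_cexp_I_div_rpow_sub_one hα]
    ring
  rw [hlim]
  have hmeas : Measurable fun y : ℝ => Complex.exp (Complex.I * ((1 / y ^ α : ℝ) : ℂ)) - 1 := by
    fun_prop
  have key : Tendsto (fun t : ℝ => ∫ y in Set.Ioi (0 : ℝ),
      (Complex.exp (Complex.I * ((1 / y ^ α : ℝ) : ℂ)) - 1) * (φ (t ^ (1 / α) * y) : ℂ)) (𝓝[>] 0)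
      (𝓝 (∫ y in Set.Ioi (0 : ℝ),
        (Complex.exp (Complex.I * ((1 / y ^ α : ℝ) : ℂ)) - 1) * (φ 0 : ℂ))) := by
    refine tendsto_integral_filter_of_dominated_convergence
      (fun y : ℝ => min (1 / y ^ α) 2 * M) ?_ ?_
      ((integrableOn_Ioi_min_rpow_neg hα).mul_const M) ?_
    · refine Eventually.of_forall fun t => Measurable.aestronglyMeasurable ?_
      have := hcont.measurable
      fun_prop
    · refine Eventually.of_forall fun t => ?_
      refine (ae_restrict_iff' measurableSet_Ioi).2 (Eventually.of_forall fun y hy => ?_)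
      have hy : 0 < y := hy
      rw [norm_mul, Complex.norm_real]
      gcongr
      · refine le_min (Real.norm_exp_I_mul_ofReal_sub_one_le.trans_eq ?_)
          (Complex.norm_exp_sub_one_le_two_of_re_nonpos (by simp [-one_div]))
        exact Real.norm_of_nonneg (by positivity)
      · exact hM _
    · refine Eventually.of_forall fun y => ?_
      have hc : Continuous fun t : ℝ => φ (t ^ (1 / α) * y) :=
        hcont.comp ((Real.continuous_rpow_const (by positivity)).mul_const y)
      have h0 : Tendsto (fun t : ℝ => φ (t ^ (1 / α) * y)) (𝓝[>] 0) (𝓝 (φ 0)) :=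
        (hc.tendsto' 0 _ (by
          rw [Real.zero_rpow (by positivity), zero_mul])).mono_left nhdsWithin_le_nhds
      exact ((Complex.continuous_ofReal.tendsto _).comp h0).const_mul _
  refine key.congr' ?_
  filter_upwards [self_mem_nhdsWithin] with t ht
  have ht : 0 < t := ht
  have hc : ((t ^ (1 / α) : ℝ) : ℂ) ≠ 0 := by
    exact_mod_cast (Real.rpow_pos_of_pos ht _).ne'
  rw [oscIntegralTilde_eq_rpow_mul_integral hα0 hφ ht, mul_div_cancel_left₀ _ hc]

end

theorem corollary1p3 (α : ℝ) (hα : 0 < α) (φ : ℝ → ℝ)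
    (hφ : ContDiff ℝ ∞ φ) (hsupp : HasCompactSupport φ) :
    IntegrableOn φ (Set.Ioi (0 : ℝ)) ∧
    (∀ t : ℝ, IntegrableOn (oscIntegrand α φ t) (Set.Ioi (0 : ℝ))) ∧
    (α < 1 →
      IntegrableOn (fun x : ℝ => φ x / x ^ α) (Set.Ioi (0 : ℝ)) ∧
      Tendsto (fun t : ℝ => oscIntegralTilde α φ t / (t : ℂ)) (𝓝[≠] 0)
        (𝓝 (Complex.I * ((∫ x in Set.Ioi (0 : ℝ), φ x / x ^ α : ℝ) : ℂ)))) ∧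
    (α = 1 →
      Tendsto (fun t : ℝ => oscIntegralTilde α φ t / ((t * Real.log t : ℝ) : ℂ)) (𝓝[>] 0)
        (𝓝 (-Complex.I * (φ 0 : ℂ)))) ∧
    (1 < α →
      Tendsto (fun t : ℝ => oscIntegralTilde α φ t / ((t ^ (1 / α) : ℝ) : ℂ)) (𝓝[>] 0)
        (𝓝 ((1 / (α : ℂ)) * (φ 0 : ℂ) *
          Complex.exp (-(1 / (2 * (α : ℂ))) * (Real.pi : ℂ) * Complex.I) *
          (Real.Gamma (-(1 / α)) : ℂ)))) := by
  have hint : IntegrableOn φ (Set.Ioi (0 : ℝ)) :=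
    (hφ.continuous.integrable_of_hasCompactSupport hsupp).integrableOn
  -- Besides integrability and continuity, only a sup bound and a Lipschitz constant of `φ` enter
  -- the estimates.
  obtain ⟨M, hM⟩ := hsupp.exists_bound_of_continuous hφ.continuous
  obtain ⟨L, hL⟩ := hφ.lipschitzWith_of_hasCompactSupport hsupp (by simp)
  refine ⟨hint, integrableOn_oscIntegrand hint, fun h1 => ?_, ?_, fun h1 => ?_⟩
  · have h := integrableOn_div_rpow hα h1 hM hint
    exact ⟨h, tendsto_oscIntegralTilde_div hint h⟩
  · rintro rfl
    exact tendsto_oscIntegralTilde_one_div_mul_log hint hM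
      fun x => by simpa using hL.norm_sub_le x 0
  · exact tendsto_oscIntegralTilde_div_rpow h1 hint hφ.continuous hM
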